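/- Let $P=((V,E),(V_1,V_R),\delta)$ be a Markov decision process: $(V,E)$ is a finite directed graph, $V$ is partitioned into player-1 vertices $V_1$ and random vertices $V_R$, and $\delta$ assigns to each $v\in V_R$ a probability distribution on $V$ with $\delta(v)[w]>0$ if and only if $(v,w)\in E$. A play is an infinite path in $(V,E)$; $\Omega$ is the set of plays, and $\mathrm{Inf}(\omega)$ is the set of vertices that occur infinitely often in $\omega\in\Omega$. A player-1 strategy $\sigma$ (which may depend on the whole history) assigns to every finite prefix of a play that ends in a vertex $v\in V_1$ a vertex $w$ with $(v,w)\in E$. $\Pr_v^\sigma$ is the probability when starting at $v$, playing $\sigma$ at the player-1 vertices and moving according to $\delta$ at the random vertices. For an objective $\psi\subseteq\Omega$, the almost-sure winning set $\mathrm{AS}(P,\psi)$ is the set of vertices $v$ for which there is a strategy $\sigma$ with $\Pr_v^\sigma(\psi)=1$. For $T\subseteq V$, $\mathrm{Reach}(T)$ is the set of plays that contain a vertex of $T$. An end-component of $P$ is a set $X\subseteq V$ such that the subgraph induced by $X$ is strongly connected and contains at least one edge, and every edge $(u,w)\in E$ with $u\in X\cap V_R$ satisfies $w\in X$. It is a good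 $\psi$ end-component if every play $\omega\in\Omega$ with $\mathrm{Inf}(\omega)=X$ belongs to $\psi$. Let $\psi\subseteq\Omega$ be an objective determined by $\mathrm{Inf}$, i.e. whenever $\omega,\omega'\in\Omega$ and $\mathrm{Inf}(\omega)=\mathrm{Inf}(\omega')$, then $\omega\in\psi$ if and only if $\omega'\in\psi$. Then: 1. If $\mathcal X_\psi$ is the set of all good $\psi$ end-components of $P$, then $$\mathrm{AS}(P,\psi)=\mathrm{AS}\Bigl(P,\mathrm{Reach}\Bigl(\bigcup_{X\in\mathcal X_\psi}X\Bigr)\Bigr).$$ 2. For every set $\mathcal X$ of good $\psi$ end-components of $P$, $$\mathrm{AS}\Bigl(P,\mathrm{Reach}\Bigl(\bigcup_{X\in\mathcal X}X\Bigr)\Bigr)\subseteq\mathrm{AS}(P,\psi).$$ -/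

import Mathlib

open MeasureTheory ProbabilityTheory Finset
open scoped ENNReal

/-- A Markov decision process on the vertex set `V`: a directed graph, a partition of the vertices
into player-1 vertices and random vertices, and for each random vertex a probability distribution
on `V` whose support is the set of successors of that vertex. -/
structure MDP (V : Type*) where
  /-- `Edge u v`: there is an edge from `u` to `v`. -/
  Edge : V → V → Prop
  /-- The player-1 vertices. -/
  player1 : Set V
  /-- The random vertices. -/
  random : Set V
  partition : IsCompl player1 random
  /-- The probabilistic transition function. -/
  δ : random → PMF V
  edge_iff : ∀ (v : random) (w : V), Edge v w ↔ 0 < δ v w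

namespace MDP

variable {V : Type*}

/-- The set `Ω` of plays, i.e. of infinite paths. -/
def plays (P : MDP V) : Set (ℕ → V) :=
  {ω | ∀ i, P.Edge (ω i) (ω (i + 1))}

/-- The set of vertices that occur infinitely often in a sequence. -/
def infOften (ω : ℕ → V) : Set V :=
  {v | {n | ω n = v}.Infinite}

/-- A player-1 strategy. A finite word `v₀ v₁ … vₙ` is a map `Iic n → V`. On each finite prefix of
a play that ends in a player-1 vertex, the chosen vertex is a successor of that vertex. The values
on all other words carry no condition: they are never used at a random vertex, and sequences
through words that are not prefixes of plays are outside `plays`. -/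
structure Strategy (P : MDP V) where
  next : (n : ℕ) → (Iic n → V) → V
  edge_next : ∀ ω ∈ P.plays, ∀ n, ω n ∈ P.player1 →
    P.Edge (ω n) (next n (Preorder.frestrictLe n ω))

/-- The last vertex of a word `v₀ v₁ … vₙ`. -/
def lastVertex {n : ℕ} (h : Iic n → V) : V :=
  h ⟨n, mem_Iic.2 le_rfl⟩

section Probability

variable [MeasurableSpace V]

open Classical in
/-- The distribution of the next vertex after the word `h`, when player 1 plays `σ`. -/
noncomputable def nextLaw (P : MDP V) (σ : P.Strategy) (n : ℕ) (h : Iic n → V) : Measure V :=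
  if hv : lastVertex h ∈ P.random then (P.δ ⟨lastVertex h, hv⟩).toMeasure
  else Measure.dirac (σ.next n h)

instance (P : MDP V) (σ : P.Strategy) (n : ℕ) (h : Iic n → V) :
    IsProbabilityMeasure (P.nextLaw σ n h) := by
  unfold nextLaw
  split_ifs <;> infer_instance

variable [Finite V] [DiscreteMeasurableSpace V]

/-- `nextLaw` as a Markov kernel. -/
noncomputable def stepKernel (P : MDP V) (σ : P.Strategy) (n : ℕ) : Kernel (Iic n → V) V :=
  Kernel.ofFunOfCountable (P.nextLaw σ n)

instance (P : MDP V) (σ : P.Strategy) (n : ℕ) : IsMarkovKernel (P.stepKernel σ n) :=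
  ⟨fun h => inferInstanceAs (IsProbabilityMeasure (P.nextLaw σ n h))⟩

/-- The law of the random infinite vertex sequence that starts at `v` and is generated with
player 1 playing `σ`, on the product σ-algebra of `ℕ → V`. -/
noncomputable def pr (P : MDP V) (σ : P.Strategy) (v : V) : Measure (ℕ → V) :=
  Kernel.traj (X := fun _ => V) (P.stepKernel σ) 0 (fun _ => v)

/-- The almost-sure winning set of player 1 for the objective `ψ`. -/
def almostSure (P : MDP V) (ψ : Set (ℕ → V)) : Set V :=
  {v | ∃ σ : P.Strategy, P.pr σ v ψ = 1}

end Probability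

/-- The reachability objective with target set `T`. -/
def reach (P : MDP V) (T : Set V) : Set (ℕ → V) :=
  {ω ∈ P.plays | ∃ j, ω j ∈ T}

/-- Membership of a play in the objective `ψ` depends only on the set of vertices that the play
visits infinitely often. -/
def DeterminedByInf (P : MDP V) (ψ : Set (ℕ → V)) : Prop :=
  ∀ ω ∈ P.plays, ∀ ω' ∈ P.plays, infOften ω = infOften ω' → (ω ∈ ψ ↔ ω' ∈ ψ)

/-- The edge relation of the sub-MDP induced by `X`. -/
def InducedEdge (P : MDP V) (X : Set V) (u v : V) : Prop :=
  u ∈ X ∧ v ∈ X ∧ P.Edge u v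

/-- End-components: the induced sub-MDP is strongly connected, edges from its random vertices do
not leave it, and it contains at least one edge. -/
structure IsEndComponent (P : MDP V) (X : Set V) : Prop where
  stronglyConnected : ∀ u ∈ X, ∀ v ∈ X, Relation.ReflTransGen (P.InducedEdge X) u v
  closed_random : ∀ u ∈ X ∩ P.random, ∀ v, P.Edge u v → v ∈ X
  exists_edge : ∃ u v, P.InducedEdge X u v

/-- Good `ψ` end-components: every play whose set of infinitely often visited vertices is exactly
the end-component satisfies `ψ`. -/
structure IsGoodEndComponent (P : MDP V) (ψ : Set (ℕ → V)) (X : Set V) : Prop where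
  isEndComponent : P.IsEndComponent X
  good : ∀ ω ∈ P.plays, infOften ω = X → ω ∈ ψ

end MDP

namespace MDP

variable {V : Type*}

/-! Under every strategy, almost surely the set of vertices visited infinitely often is closed under
edges from random vertices: each visit to a random vertex `u` offers a successor `w` the same
positive conditional probability, so Lévy's conditional Borel–Cantelli lemma applies
(`ae_mem_infOften_of_edge`). On a play, this set is therefore an end-component
(`isEndComponent_infOften`). If the play lies in `ψ`, determinacy by `infOften` makes the
end-component good, so a strategy that wins `ψ` also reaches the union of the good ones.

Conversely, let `σ` reach a union of good end-components almost surely. Follow `σ` until the first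
hit `x`, fix an end-component containing `x`, and from then on let player 1 cycle through the
successors inside it (`roundRobin`). The play never leaves the component, and its limit set is
closed under the component's edges, hence is the whole component (`ae_infOften_roundRobin`).
Changing `σ` only after the hit does not affect the probability of hitting (`ae_reach_congr`). -/

theorem nextLaw_of_mem_random [MeasurableSpace V] (P : MDP V) (σ : P.Strategy) {n : ℕ}
    {h : Iic n → V} (hv : lastVertex h ∈ P.random) :
    P.nextLaw σ n h = (P.δ ⟨lastVertex h, hv⟩).toMeasure := by
  rw [nextLaw, dif_pos hv]

theorem nextLaw_of_notMem_random [MeasurableSpace V] (P : MDP V) (σ : P.Strategy) {n : ℕ}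
    {h : Iic n → V} (hv : lastVertex h ∉ P.random) :
    P.nextLaw σ n h = Measure.dirac (σ.next n h) := by
  rw [nextLaw, dif_neg hv]

theorem mem_player1_or_mem_random (P : MDP V) (v : V) : v ∈ P.player1 ∨ v ∈ P.random := by
  by_contra! h
  have := P.partition.codisjoint
  rw [codisjoint_iff_le_sup] at this
  rcases this (Set.mem_univ v) with hv | hv
  exacts [h.1 hv, h.2 hv]

theorem notMem_random_of_mem_player1 (P : MDP V) {v : V} (h : v ∈ P.player1) : v ∉ P.random :=
  Set.disjoint_left.1 P.partition.disjoint h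

theorem exists_frestrictLe_eq {n : ℕ} (h : Iic n → V) :
    ∃ ω : ℕ → V, Preorder.frestrictLe (π := fun _ => V) n ω = h := by
  classical
  refine ⟨fun k => if hk : k ≤ n then h ⟨k, mem_Iic.2 hk⟩ else lastVertex h, ?_⟩
  ext ⟨k, hk⟩
  simp [Preorder.frestrictLe_apply, mem_Iic.1 hk]

/-! ### Cylinder probabilities and the conditional Borel–Cantelli argument -/

section Law

variable [Finite V] [MeasurableSpace V] [DiscreteMeasurableSpace V]

instance isProbabilityMeasure_pr (P : MDP V) (σ : P.Strategy) (v : V) :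
    IsProbabilityMeasure (P.pr σ v) := by
  unfold pr; infer_instance

/-- The joint law of the word of length `n + 1` and the vertex that follows it. -/
theorem map_prodMk_pr (P : MDP V) (σ : P.Strategy) (v : V) (n : ℕ) :
    (P.pr σ v).map (fun ω => (Preorder.frestrictLe (π := fun _ => V) n ω, ω (n + 1))) =
      (P.pr σ v).map (Preorder.frestrictLe n) ⊗ₘ P.stepKernel σ n := by
  unfold pr
  rw [Kernel.traj_map_frestrictLe_apply]
  exact (Kernel.partialTraj_compProd_eq_map_traj (Nat.zero_le n)).symm

/-- The probability of a cylinder is computed by one-step extension. -/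
theorem pr_cylinder_succ (P : MDP V) (σ : P.Strategy) (v : V) (n : ℕ) (η : ℕ → V) :
    P.pr σ v {ω | Preorder.frestrictLe (π := fun _ => V) (n + 1) ω =
        Preorder.frestrictLe (π := fun _ => V) (n + 1) η} =
      P.pr σ v {ω | Preorder.frestrictLe (π := fun _ => V) n ω =
        Preorder.frestrictLe (π := fun _ => V) n η} *
      P.nextLaw σ n (Preorder.frestrictLe n η) {η (n + 1)} := by
  have h1 : {ω : ℕ → V | Preorder.frestrictLe (π := fun _ => V) (n + 1) ω =
        Preorder.frestrictLe (π := fun _ => V) (n + 1) η} =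
      (fun ω => (Preorder.frestrictLe (π := fun _ => V) n ω, ω (n + 1))) ⁻¹'
        ({Preorder.frestrictLe (π := fun _ => V) n η} ×ˢ {η (n + 1)}) := by
    ext ω
    simp only [Set.mem_ofPred_eq, Set.mem_preimage, Set.mem_prod, Set.mem_singleton_iff,
      funext_iff, Subtype.forall, Preorder.frestrictLe_apply, mem_Iic]
    constructor
    · exact fun h => ⟨fun k hk => h k (by omega), h _ le_rfl⟩
    · rintro ⟨h, h'⟩ k hk
      rcases Nat.le_succ_iff.1 hk with hk | rfl
      · exact h k hk
      · exact h'
  rw [h1, ← Measure.map_apply (by fun_prop) (by measurability), map_prodMk_pr,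
    Measure.compProd_apply_prod (by measurability) (by measurability)]
  simp only [lintegral_singleton]
  rw [mul_comm, Measure.map_apply (by fun_prop) (by measurability)]
  rfl

theorem pr_preimage_frestrictLe (P : MDP V) (σ : P.Strategy) (v : V) (n : ℕ)
    (S : Set (Iic n → V)) :
    P.pr σ v (Preorder.frestrictLe (π := fun _ => V) n ⁻¹' S) =
      ∑' h, S.indicator
        (fun h => P.pr σ v {ω | Preorder.frestrictLe (π := fun _ => V) n ω = h}) h := by
  rw [← Measure.map_apply (by fun_prop) (Set.toFinite S).measurableSet,
    ← Measure.tsum_indicator_apply_singleton _ _ (Set.toFinite S).measurableSet]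
  congr! 3
  ext h
  rw [Measure.map_apply (by fun_prop) (by measurability)]
  rfl

/-- Almost surely, every step has positive probability. -/
theorem ae_nextLaw_ne_zero (P : MDP V) (σ : P.Strategy) (v : V) :
    ∀ᵐ (ω : ℕ → V) ∂P.pr σ v, ∀ n, P.nextLaw σ n (Preorder.frestrictLe n ω) {ω (n + 1)} ≠ 0 := by
  rw [ae_all_iff]
  intro n
  rw [ae_iff]
  simp only [not_not]
  have h1 : {ω : ℕ → V | P.nextLaw σ n (Preorder.frestrictLe n ω) {ω (n + 1)} = 0} =
      Preorder.frestrictLe (π := fun _ => V) (n + 1) ⁻¹'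
        {h | P.nextLaw σ n (fun k => h ⟨k, mem_Iic.2 ((mem_Iic.1 k.2).trans n.le_succ)⟩)
          {h ⟨n + 1, mem_Iic.2 le_rfl⟩} = 0} := rfl
  -- The event is a finite union of cylinders, and each of them has a zero factor in its last step.
  rw [h1, pr_preimage_frestrictLe, ENNReal.tsum_eq_zero]
  intro h
  obtain ⟨η, rfl⟩ := exists_frestrictLe_eq h
  refine Set.indicator_apply_eq_zero.2 fun hη => ?_
  rw [pr_cylinder_succ]
  have : P.nextLaw σ n (Preorder.frestrictLe n η) {η (n + 1)} = 0 := hη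
  rw [this, mul_zero]

theorem nextLaw_singleton_of_mem_random (P : MDP V) (σ : P.Strategy) {n : ℕ} {ω : ℕ → V}
    (hω : ω n ∈ P.random) (w : V) :
    P.nextLaw σ n (Preorder.frestrictLe n ω) {w} = P.δ ⟨ω n, hω⟩ w := by
  rw [nextLaw_of_mem_random P σ (h := Preorder.frestrictLe (π := fun _ => V) n ω) hω,
    PMF.toMeasure_apply_singleton _ _ (measurableSet_singleton w)]
  rfl

theorem edge_of_nextLaw_ne_zero (P : MDP V) (σ : P.Strategy) {n : ℕ} {ω : ℕ → V}
    (h : P.nextLaw σ n (Preorder.frestrictLe n ω) {ω (n + 1)} ≠ 0) (hω : ω n ∈ P.random) :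
    P.Edge (ω n) (ω (n + 1)) := by
  rw [P.nextLaw_singleton_of_mem_random σ hω] at h
  exact (P.edge_iff ⟨ω n, hω⟩ _).2 (pos_iff_ne_zero.2 h)

theorem eq_next_of_nextLaw_ne_zero (P : MDP V) (σ : P.Strategy) {n : ℕ} {ω : ℕ → V}
    (h : P.nextLaw σ n (Preorder.frestrictLe n ω) {ω (n + 1)} ≠ 0) (hω : ω n ∈ P.player1) :
    ω (n + 1) = σ.next n (Preorder.frestrictLe n ω) := by
  rw [nextLaw_of_notMem_random P σ (h := Preorder.frestrictLe (π := fun _ => V) n ω)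
    (P.notMem_random_of_mem_player1 hω), Measure.dirac_apply' _ (measurableSet_singleton _)] at h
  by_contra hne
  exact h (Set.indicator_of_notMem (fun h' => hne (Set.mem_singleton_iff.1 h').symm) _)

/-- The conditional probability that the next vertex is `w`. -/
theorem condExp_next (P : MDP V) (σ : P.Strategy) (v : V) (n : ℕ) (w : V) :
    (P.pr σ v)[{ω : ℕ → V | ω (n + 1) = w}.indicator (1 : (ℕ → V) → ℝ) |
        Filtration.piLE (X := fun _ => V) n] =ᵐ[P.pr σ v]
      fun ω => (P.nextLaw σ n (Preorder.frestrictLe n ω)).real {w} := by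
  have hm : MeasurableSet {ω : ℕ → V | ω (n + 1) = w} :=
    measurableSet_eq_fun (measurable_pi_apply (n + 1)) measurable_const
  have h := Kernel.condExp_traj (X := fun _ => V) (κ := P.stepKernel σ) (Nat.zero_le n)
    (x₀ := fun _ => v) (f := {ω : ℕ → V | ω (n + 1) = w}.indicator (1 : (ℕ → V) → ℝ))
    ((integrable_const (1 : ℝ)).indicator hm)
  refine h.trans (Filter.Eventually.of_forall fun ω => ?_)
  simp only
  rw [integral_indicator_one hm]
  have h2 : P.nextLaw σ n (Preorder.frestrictLe n ω) =
      (Kernel.traj (X := fun _ => V) (P.stepKernel σ) n (Preorder.frestrictLe n ω)).map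
        (fun x => x (n + 1)) := by
    rw [← Kernel.map_apply _ (by fun_prop), Kernel.map_traj_succ_self]
    rfl
  rw [h2, map_measureReal_apply (by fun_prop) (measurableSet_singleton w)]
  rfl

/-- Almost surely, if a random vertex is visited infinitely often, then so is each successor. -/
theorem ae_mem_infOften_of_edge (P : MDP V) (σ : P.Strategy) (v : V) :
    ∀ᵐ ω ∂P.pr σ v, ∀ u ∈ P.random, ∀ w, P.Edge u w → u ∈ infOften ω → w ∈ infOften ω := by
  have hc : ∀ w, ∀ᵐ ω ∂P.pr σ v, ∀ n,
      ((P.pr σ v)[{ω : ℕ → V | ω (n + 1) = w}.indicator (1 : (ℕ → V) → ℝ) |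
        Filtration.piLE (X := fun _ => V) n]) ω =
      (P.nextLaw σ n (Preorder.frestrictLe n ω)).real {w} :=
    fun w => ae_all_iff.2 fun n => P.condExp_next σ v n w
  -- Lévy's extension of Borel–Cantelli: `w` is visited infinitely often iff the conditional
  -- probabilities of moving to `w` have divergent sum.
  have hb : ∀ w, ∀ᵐ ω ∂P.pr σ v, _ := fun w =>
    ae_mem_limsup_atTop_iff (ℱ := Filtration.piLE (X := fun _ => V)) (P.pr σ v)
      (s := fun n => {ω : ℕ → V | ω n = w}) (fun n => by
        have : {ω : ℕ → V | ω n = w} = Preorder.restrictLe (π := fun _ => V) n ⁻¹'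
          {h | h ⟨n, le_refl n⟩ = w} := rfl
        rw [this]
        exact ⟨_, measurable_pi_apply _ (measurableSet_singleton w), rfl⟩)
  filter_upwards [ae_all_iff.2 hc, ae_all_iff.2 hb] with ω h1 h2 u hu w huw hinf
  have hpos : 0 < (P.δ ⟨u, hu⟩ w).toReal :=
    ENNReal.toReal_pos ((P.edge_iff ⟨u, hu⟩ w).1 huw).ne' ((P.δ ⟨u, hu⟩).apply_ne_top w)
  have h3 := (h2 w).2 (by
    simp only [h1 w]
    -- The summand equals the constant `P.δ u w > 0` at every visit to `u`, so the terms do not tend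
    -- to zero.
    refine (not_summable_iff_tendsto_nat_atTop_of_nonneg (fun _ => measureReal_nonneg)).1 ?_
    intro hs
    have h4 := hs.tendsto_atTop_zero.eventually (gt_mem_nhds hpos)
    obtain ⟨n, hn, hn'⟩ := ((Nat.frequently_atTop_iff_infinite.2 hinf).and_eventually h4).exists
    subst hn
    rw [measureReal_def, P.nextLaw_singleton_of_mem_random σ hu] at hn'
    exact lt_irrefl _ hn')
  exact Nat.frequently_atTop_iff_infinite.1
    (Filter.mem_limsup_iff_frequently_mem (s := fun n => {ω : ℕ → V | ω n = w}).1 h3)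

end Law

/-! ### Limit sets of plays -/

theorem reflTransGen_inducedEdge (P : MDP V) {ω : ℕ → V} (hω : ω ∈ P.plays) {X : Set V} {N : ℕ}
    (hN : ∀ n ≥ N, ω n ∈ X) {m n : ℕ} (hm : N ≤ m) (hmn : m ≤ n) :
    Relation.ReflTransGen (P.InducedEdge X) (ω m) (ω n) := by
  induction n, hmn using Nat.le_induction with
  | base => exact .refl
  | succ n hn ih => exact ih.tail ⟨hN n (hm.trans hn), hN _ (by omega), hω n⟩

section Limit

variable [Finite V]

theorem eventually_mem_infOften (ω : ℕ → V) : ∃ N, ∀ n ≥ N, ω n ∈ infOften ω := by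
  have h : {n | ω n ∉ infOften ω}.Finite := by
    have : {n | ω n ∉ infOften ω} = ⋃ v ∈ (infOften ω)ᶜ, {n | ω n = v} := by
      ext n; simp
    rw [this]
    exact (Set.toFinite _).biUnion fun v hv => Set.not_infinite.1 hv
  obtain ⟨N, hN⟩ := h.bddAbove
  exact ⟨N + 1, fun n hn => by
    by_contra hc
    have : n ≤ N := hN hc
    omega⟩

/-- From some time on the play stays in its limit set, and its later segments are paths between any
two vertices of that set. -/
theorem isEndComponent_infOften (P : MDP V) {ω : ℕ → V} (hω : ω ∈ P.plays)
    (h : ∀ u ∈ P.random, ∀ w, P.Edge u w → u ∈ infOften ω → w ∈ infOften ω) :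
    P.IsEndComponent (infOften ω) := by
  obtain ⟨N, hN⟩ := eventually_mem_infOften ω
  refine ⟨fun u hu w hw => ?_, fun u hu w huw => h u hu.2 w huw hu.1,
    ω N, ω (N + 1), hN N le_rfl, hN _ (by omega), hω N⟩
  obtain ⟨m, rfl, hm⟩ := Set.Infinite.exists_gt hu N
  obtain ⟨n, rfl, hn⟩ := Set.Infinite.exists_gt hw m
  exact P.reflTransGen_inducedEdge hω hN hm.le hn.le

end Limit

/-! ### End-components and strategies given by choice functions -/

theorem IsEndComponent.exists_successor {P : MDP V} {X : Set V} (hX : P.IsEndComponent X) {u : V}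
    (hu : u ∈ X) : ∃ w ∈ X, P.Edge u w := by
  obtain ⟨a, b, ha, hb, hab⟩ := hX.exists_edge
  rcases (hX.stronglyConnected u hu a ha).cases_head with rfl | ⟨c, hc, -⟩
  · exact ⟨b, hb, hab⟩
  · exact ⟨c, hc.2.1, hc.2.2⟩

/-- In an end-component, the successors of a vertex can be enumerated with infinite
repetition. -/
theorem IsEndComponent.exists_enumeration [Finite V] {P : MDP V} {X : Set V}
    (hX : P.IsEndComponent X) {u : V} (hu : u ∈ X) :
    ∃ c : ℕ → V, (∀ k, c k ∈ X ∧ P.Edge u (c k)) ∧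
      ∀ w ∈ X, P.Edge u w → {k | c k = w}.Infinite := by
  obtain ⟨w₀, hw₀, hw₀'⟩ := hX.exists_successor hu
  have : Nonempty {w // w ∈ X ∧ P.Edge u w} := ⟨⟨w₀, hw₀, hw₀'⟩⟩
  obtain ⟨g, hg⟩ := exists_surjective_nat {w // w ∈ X ∧ P.Edge u w}
  -- The value `g a` is taken at every index `Nat.pair a b`, hence infinitely often.
  refine ⟨fun k => g (Nat.unpair k).1, fun k => (g _).2, fun w hw hw' => ?_⟩
  obtain ⟨a, ha⟩ := hg ⟨w, hw, hw'⟩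
  refine Set.infinite_of_injective_forall_mem (f := fun b => Nat.pair a b) ?_ ?_
  · intro b b' h
    exact (Nat.pair_eq_pair.1 h).2
  · intro b
    simp [ha]

theorem IsEndComponent.eq_of_closed {P : MDP V} {X Y : Set V} (hX : P.IsEndComponent X)
    (hYX : Y ⊆ X) (hY : Y.Nonempty) (h : ∀ u ∈ Y, ∀ w ∈ X, P.Edge u w → w ∈ Y) : Y = X := by
  refine hYX.antisymm fun w hw => ?_
  obtain ⟨u, hu⟩ := hY
  have := hX.stronglyConnected u (hYX hu) w hw
  clear hw
  induction this with
  | refl => exact hu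
  | tail _ hbc ih => exact h _ ih _ hbc.2.1 hbc.2.2

/-- A strategy is given by a choice function that depends only on the past. -/
def Strategy.ofCausal (P : MDP V) (F : ℕ → (ℕ → V) → V)
    (hF : ∀ n ω ω', (∀ j ≤ n, ω j = ω' j) → F n ω = F n ω')
    (hE : ∀ ω ∈ P.plays, ∀ n, ω n ∈ P.player1 → P.Edge (ω n) (F n ω)) : P.Strategy where
  -- The word is padded to a sequence by repeating its last vertex; by `hF` the padding has no
  -- influence.
  next n h := F n fun k => if hk : k ≤ n then h ⟨k, mem_Iic.2 hk⟩ else lastVertex h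
  edge_next ω hω n hn := by
    rw [hF n _ ω]
    · exact hE ω hω n hn
    · intro j hj
      simp [hj, Preorder.frestrictLe_apply]

theorem Strategy.ofCausal_next (P : MDP V) (F : ℕ → (ℕ → V) → V)
    (hF : ∀ n ω ω', (∀ j ≤ n, ω j = ω' j) → F n ω = F n ω')
    (hE : ∀ ω ∈ P.plays, ∀ n, ω n ∈ P.player1 → P.Edge (ω n) (F n ω)) (n : ℕ) (ω : ℕ → V) :
    (Strategy.ofCausal P F hF hE).next n (Preorder.frestrictLe n ω) = F n ω := by
  refine hF n _ ω fun j hj => ?_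
  simp [hj, Preorder.frestrictLe_apply]

/-! ### Strategies that agree before the target -/

section Agreement

variable [Finite V] [MeasurableSpace V] [DiscreteMeasurableSpace V]

/-- Two strategies that agree on the words avoiding `T` give the same probability to each word
without proper prefix meeting `T`. -/
theorem pr_cylinder_congr (P : MDP V) {σ τ : P.Strategy} {T : Set V}
    (h : ∀ n, ∀ ω : ℕ → V, (∀ j ≤ n, ω j ∉ T) →
      τ.next n (Preorder.frestrictLe n ω) = σ.next n (Preorder.frestrictLe n ω))
    (v : V) (n : ℕ) (η : ℕ → V) (hη : ∀ j < n, η j ∉ T) :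
    P.pr τ v {ω | Preorder.frestrictLe (π := fun _ => V) n ω =
        Preorder.frestrictLe (π := fun _ => V) n η} =
      P.pr σ v {ω | Preorder.frestrictLe (π := fun _ => V) n ω =
        Preorder.frestrictLe (π := fun _ => V) n η} := by
  induction n with
  | zero =>
    have h0 : ∀ σ : P.Strategy, P.pr σ v {ω | Preorder.frestrictLe (π := fun _ => V) 0 ω =
        Preorder.frestrictLe (π := fun _ => V) 0 η} =
        Measure.dirac (fun _ => v) {Preorder.frestrictLe (π := fun _ => V) 0 η} := by
      intro σ
      have := Kernel.traj_map_frestrictLe_apply (X := fun _ => V) (κ := P.stepKernel σ) 0 0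
        (fun _ => v)
      rw [Kernel.partialTraj_self, Kernel.id_apply] at this
      rw [← this, Measure.map_apply (by fun_prop) (by measurability)]
      rfl
    rw [h0, h0]
  | succ n ih =>
    rw [pr_cylinder_succ, pr_cylinder_succ, ih fun j hj => hη j (by omega)]
    congr 2
    rw [nextLaw, nextLaw, h n η fun j hj => hη j (by omega)]

/-- Such an event is a finite union of cylinders to which `pr_cylinder_congr` applies. -/
theorem pr_congr_of_avoid (P : MDP V) {σ τ : P.Strategy} {T : Set V}
    (h : ∀ n, ∀ ω : ℕ → V, (∀ j ≤ n, ω j ∉ T) →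
      τ.next n (Preorder.frestrictLe n ω) = σ.next n (Preorder.frestrictLe n ω))
    (v : V) (n : ℕ) {B : Set (ℕ → V)} (hB : ∀ ω ω', (∀ j ≤ n, ω j = ω' j) → ω ∈ B → ω' ∈ B)
    (hT : ∀ ω ∈ B, ∀ j < n, ω j ∉ T) : P.pr τ v B = P.pr σ v B := by
  have hB' : B = Preorder.frestrictLe (π := fun _ => V) n ⁻¹'
      (Preorder.frestrictLe (π := fun _ => V) n '' B) := by
    refine (Set.subset_preimage_image _ _).antisymm ?_
    rintro ω ⟨ω', hω', he⟩
    exact hB ω' ω (fun j hj => congrFun he ⟨j, mem_Iic.2 hj⟩) hω'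
  rw [hB', pr_preimage_frestrictLe, pr_preimage_frestrictLe]
  refine tsum_congr fun w => ?_
  by_cases hw : w ∈ Preorder.frestrictLe (π := fun _ => V) n '' B
  · rw [Set.indicator_of_mem hw, Set.indicator_of_mem hw]
    obtain ⟨η, hη, rfl⟩ := hw
    exact P.pr_cylinder_congr h v n η (hT η hη)
  · rw [Set.indicator_of_notMem hw, Set.indicator_of_notMem hw]

/-- The property that a sequence follows edges until it meets `T`, and that it meets `T`, holds
almost surely under `τ` if it does under `σ`, provided that the two agree before `T`. -/
theorem ae_reach_congr (P : MDP V) {σ τ : P.Strategy} {T : Set V}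
    (h : ∀ n, ∀ ω : ℕ → V, (∀ j ≤ n, ω j ∉ T) →
      τ.next n (Preorder.frestrictLe n ω) = σ.next n (Preorder.frestrictLe n ω))
    {v : V} (hv : P.pr σ v (P.reach T) = 1) :
    ∀ᵐ ω ∂P.pr τ v, (∃ j, ω j ∈ T) ∧
      ∀ n, (∀ j ≤ n, ω j ∉ T) → P.Edge (ω n) (ω (n + 1)) := by
  have hm : ∀ n, ∀ S : Set V, MeasurableSet {ω : ℕ → V | ω n ∈ S} := fun n S =>
    measurable_pi_apply n (Set.toFinite S).measurableSet
  have hme : ∀ n, MeasurableSet {ω : ℕ → V | P.Edge (ω n) (ω (n + 1))} := fun n =>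
    (show Measurable fun ω : ℕ → V => (ω n, ω (n + 1)) by fun_prop)
      (Set.toFinite {p : V × V | P.Edge p.1 p.2}).measurableSet
  have hreach : MeasurableSet (P.reach T) := by
    have : P.reach T = (⋂ n, {ω : ℕ → V | P.Edge (ω n) (ω (n + 1))}) ∩ ⋃ n, {ω | ω n ∈ T} := by
      ext ω; simp [reach, plays]
    rw [this]
    exact (MeasurableSet.iInter hme).inter (MeasurableSet.iUnion fun n => hm n T)
  have hae : ∀ᵐ ω ∂P.pr σ v, ω ∈ P.reach T := (mem_ae_iff_prob_eq_one hreach).2 hv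
  refine Filter.Eventually.and ?_ ?_
  -- Agreement is known only for events of finite horizon, so never hitting `T` is written as a
  -- decreasing limit of such events.
  · have hanti : Antitone fun n => {ω : ℕ → V | ∀ j ≤ n, ω j ∉ T} :=
      fun m n hmn ω hω j hj => hω j (hj.trans hmn)
    have hmeas : ∀ n, MeasurableSet {ω : ℕ → V | ∀ j ≤ n, ω j ∉ T} := fun n => by
      have : {ω : ℕ → V | ∀ j ≤ n, ω j ∉ T} = ⋂ j, ⋂ (_ : j ≤ n), {ω | ω j ∈ Tᶜ} := by
        ext ω; simp
      rw [this]
      exact MeasurableSet.iInter fun j => MeasurableSet.iInter fun _ => hm j _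
    have hcompl : ∀ ρ : P.Strategy, P.pr ρ v {ω | ¬ ∃ j, ω j ∈ T} =
        ⨅ n, P.pr ρ v {ω | ∀ j ≤ n, ω j ∉ T} := fun ρ => by
      rw [← hanti.measure_iInter (fun n => (hmeas n).nullMeasurableSet)
        ⟨0, measure_ne_top _ _⟩]
      congr 1
      ext ω
      simp only [Set.mem_ofPred_eq, Set.mem_iInter, not_exists]
      exact ⟨fun hω n j _ => hω j, fun hω j => hω j j le_rfl⟩
    rw [ae_iff, hcompl, iInf_congr fun n => P.pr_congr_of_avoid h v n
      (B := {ω | ∀ j ≤ n, ω j ∉ T}) (fun ω ω' he hω j hj => he j hj ▸ hω j hj)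
      (fun ω hω j hj => hω j hj.le), ← hcompl, ← ae_iff]
    exact hae.mono fun ω hω => hω.2
  · rw [ae_all_iff]
    intro n
    rw [ae_iff, P.pr_congr_of_avoid h v (n + 1), ← ae_iff]
    · exact hae.mono fun ω hω _ => hω.1 n
    · intro ω ω' he hω
      simp only [Set.mem_ofPred_eq, Classical.not_imp] at hω ⊢
      rw [← he n (by omega), ← he (n + 1) le_rfl]
      exact ⟨fun j hj => he j (by omega) ▸ hω.1 j hj, hω.2⟩
    · intro ω hω j hj
      simp only [Set.mem_ofPred_eq, Classical.not_imp] at hω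
      exact hω.1 j (by omega)

end Agreement

/-! ### Round robin inside an end-component -/

section RoundRobin

variable (P : MDP V) (σ : P.Strategy) (T : Set V) (comp : V → Set V) (c : V → V → ℕ → V)

/-- The first vertex of `T` on a sequence that meets `T`. -/
noncomputable def firstHit (ω : ℕ → V) : V :=
  ω (sInf {j | ω j ∈ T})

theorem firstHit_congr {n : ℕ} {ω ω' : ℕ → V} (h : ∀ j ≤ n, ω j = ω' j)
    (hT : ∃ j ≤ n, ω j ∈ T) : firstHit T ω = firstHit T ω' := by
  obtain ⟨j, hj, hjT⟩ := hT
  have h1 : sInf {j | ω j ∈ T} ∈ {j | ω j ∈ T} := Nat.sInf_mem ⟨j, hjT⟩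
  have h1' : sInf {j | ω j ∈ T} ≤ n := (Nat.sInf_le hjT).trans hj
  have hjT' : ω' j ∈ T := h j hj ▸ hjT
  have h2 : sInf {j | ω' j ∈ T} ∈ {j | ω' j ∈ T} := Nat.sInf_mem ⟨j, hjT'⟩
  have h2' : sInf {j | ω' j ∈ T} ≤ n := (Nat.sInf_le hjT').trans hj
  have he : sInf {j | ω j ∈ T} = sInf {j | ω' j ∈ T} := by
    refine le_antisymm (Nat.sInf_le ?_) (Nat.sInf_le ?_)
    · exact (congrArg (· ∈ T) (h _ h2')).mpr h2
    · exact (congrArg (· ∈ T) (h _ h1')).mp h1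
  rw [firstHit, firstHit, ← he, h _ h1']

open Classical in
/-- Follow `σ` until `T` is hit at a vertex `x`; afterwards, choose at each vertex `u` of `comp x`
in turn the values of `c x u`. -/
noncomputable def roundRobinChoice (n : ℕ) (ω : ℕ → V) : V :=
  if (∃ j ≤ n, ω j ∈ T) ∧ ω n ∈ comp (firstHit T ω) then
    -- The index is the number of visits to `ω n` strictly before time `n`, including those before
    -- `T` was hit.
    c (firstHit T ω) (ω n) (Nat.count (fun j => ω j = ω n) n)
  else σ.next n (Preorder.frestrictLe n ω)

theorem roundRobinChoice_congr (n : ℕ) (ω ω' : ℕ → V) (h : ∀ j ≤ n, ω j = ω' j) :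
    roundRobinChoice P σ T comp c n ω = roundRobinChoice P σ T comp c n ω' := by
  classical
  have h1 : (∃ j ≤ n, ω j ∈ T) ↔ ∃ j ≤ n, ω' j ∈ T :=
    exists_congr fun j => and_congr_right fun hj => by rw [h j hj]
  have h2 : Preorder.frestrictLe (π := fun _ => V) n ω = Preorder.frestrictLe n ω' :=
    funext fun j => h j (mem_Iic.1 j.2)
  unfold roundRobinChoice
  by_cases hT : ∃ j ≤ n, ω j ∈ T
  · have h3 : Nat.count (fun j => ω j = ω n) n = Nat.count (fun j => ω' j = ω' n) n := by
      rw [Nat.count_eq_card_filter_range, Nat.count_eq_card_filter_range]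
      congr 1
      refine Finset.filter_congr fun j hj => ?_
      rw [h j (Finset.mem_range.1 hj).le, h n le_rfl]
    rw [h2, h3, firstHit_congr T h hT, h n le_rfl]
    simp only [h1]
  · rw [if_neg fun hc => hT hc.1, if_neg fun hc => hT (h1.2 hc.1), h2]

variable {T comp c}

/-- The strategy that follows `roundRobinChoice`. -/
noncomputable def roundRobin
    (hc : ∀ x ∈ T, ∀ u ∈ comp x, ∀ k, c x u k ∈ comp x ∧ P.Edge u (c x u k)) : P.Strategy :=
  Strategy.ofCausal P (roundRobinChoice P σ T comp c) (roundRobinChoice_congr P σ T comp c) (by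
    intro ω hω n hn
    unfold roundRobinChoice
    split_ifs with h
    · obtain ⟨⟨j, -, hj⟩, h⟩ := h
      exact (hc _ (Nat.sInf_mem (s := {j | ω j ∈ T}) ⟨j, hj⟩) _ h _).2
    · exact σ.edge_next ω hω n hn)

theorem roundRobin_next
    (hc : ∀ x ∈ T, ∀ u ∈ comp x, ∀ k, c x u k ∈ comp x ∧ P.Edge u (c x u k))
    (n : ℕ) (ω : ℕ → V) :
    (roundRobin P σ hc).next n (Preorder.frestrictLe n ω) =
      roundRobinChoice P σ T comp c n ω :=
  Strategy.ofCausal_next ..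

theorem roundRobin_next_of_avoid
    (hc : ∀ x ∈ T, ∀ u ∈ comp x, ∀ k, c x u k ∈ comp x ∧ P.Edge u (c x u k))
    (n : ℕ) (ω : ℕ → V) (h : ∀ j ≤ n, ω j ∉ T) :
    (roundRobin P σ hc).next n (Preorder.frestrictLe n ω) =
      σ.next n (Preorder.frestrictLe n ω) := by
  rw [roundRobin_next, roundRobinChoice, if_neg]
  rintro ⟨⟨j, hj, hj'⟩, -⟩
  exact h j hj hj'

open Classical in
theorem roundRobin_next_of_hit
    (hc : ∀ x ∈ T, ∀ u ∈ comp x, ∀ k, c x u k ∈ comp x ∧ P.Edge u (c x u k))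
    {n : ℕ} {ω : ℕ → V} (h : ∃ j ≤ n, ω j ∈ T) (hn : ω n ∈ comp (firstHit T ω)) :
    (roundRobin P σ hc).next n (Preorder.frestrictLe n ω) =
      c (firstHit T ω) (ω n) (Nat.count (fun j => ω j = ω n) n) := by
  rw [roundRobin_next, roundRobinChoice, if_pos ⟨h, hn⟩]

/-- If `c x u` repeats every successor of `u` in the end-component `comp x` infinitely often, then
once `T` is hit at `x`, round robin visits exactly the vertices of `comp x` infinitely often. -/
theorem ae_infOften_roundRobin [Finite V] [MeasurableSpace V] [DiscreteMeasurableSpace V]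
    (hcomp : ∀ x ∈ T, x ∈ comp x ∧ P.IsEndComponent (comp x))
    (hc : ∀ x ∈ T, ∀ u ∈ comp x, ∀ k, c x u k ∈ comp x ∧ P.Edge u (c x u k))
    (hc' : ∀ x ∈ T, ∀ u ∈ comp x, ∀ w ∈ comp x, P.Edge u w → {k | c x u k = w}.Infinite)
    {v : V} (hv : P.pr σ v (P.reach T) = 1) :
    ∀ᵐ ω ∂P.pr (roundRobin P σ hc) v, ω ∈ P.plays ∧ ∃ x ∈ T, infOften ω = comp x := by
  classical
  filter_upwards [P.ae_reach_congr (P.roundRobin_next_of_avoid σ hc) hv,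
    P.ae_nextLaw_ne_zero (roundRobin P σ hc) v,
    P.ae_mem_infOften_of_edge (roundRobin P σ hc) v] with ω ⟨hhit, hpre⟩ hstep hrand
  set x := firstHit T ω with hx
  set N := sInf {j | ω j ∈ T} with hN
  have hNT : ω N ∈ T := Nat.sInf_mem (s := {j | ω j ∈ T}) hhit
  have hxT : x ∈ T := hNT
  obtain ⟨hxX, hX⟩ := hcomp x hxT
  have hnext : ∀ n ≥ N, ω n ∈ comp x → ω n ∈ P.player1 →
      ω (n + 1) = c x (ω n) (Nat.count (fun j => ω j = ω n) n) := fun n hn hnX hn1 => by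
    rw [P.eq_next_of_nextLaw_ne_zero _ (hstep n) hn1,
      P.roundRobin_next_of_hit σ hc ⟨N, hn, hNT⟩ hnX]
  have hstay : ∀ n ≥ N, ω n ∈ comp x → P.Edge (ω n) (ω (n + 1)) ∧ ω (n + 1) ∈ comp x := by
    intro n hn hnX
    rcases P.mem_player1_or_mem_random (ω n) with h1 | h1
    · rw [hnext n hn hnX h1]
      exact (hc x hxT _ hnX _).symm
    · have he := P.edge_of_nextLaw_ne_zero _ (hstep n) h1
      exact ⟨he, hX.closed_random _ ⟨hnX, h1⟩ _ he⟩
  have hmem : ∀ n ≥ N, ω n ∈ comp x := by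
    intro n hn
    induction n, hn using Nat.le_induction with
    | base => exact hxX
    | succ n hn ih => exact (hstay n hn ih).2
  refine ⟨fun n => ?_, x, hxT, hX.eq_of_closed ?_ ?_ ?_⟩
  -- A strategy must respect edges only on prefixes of plays, so before the hit the edges come from
  -- the reachability of `σ`.
  · rcases lt_or_ge n N with hn | hn
    · exact hpre n fun j hj => Nat.notMem_of_lt_sInf (s := {j | ω j ∈ T}) (hj.trans_lt hn)
    · exact (hstay n hn (hmem n hn)).1
  · intro u hu
    obtain ⟨n, rfl, hn⟩ := Set.Infinite.exists_gt hu N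
    exact hmem n hn.le
  · obtain ⟨M, hM⟩ := eventually_mem_infOften ω
    exact ⟨_, hM M le_rfl⟩
  · intro u hu w hw huw
    rcases P.mem_player1_or_mem_random u with h1 | h1
    swap
    · exact hrand u h1 w huw hu
    have huX : u ∈ comp x := by
      obtain ⟨n, rfl, hn⟩ := Set.Infinite.exists_gt hu N
      exact hmem n hn.le
    have hinf : {n | ω n = u}.Infinite := hu
    -- Visit number `k` to `u` moves to `c x u k`. Discarding `k < N` suffices, since visit number
    -- `k` happens at time at least `k`, hence not before the hit.
    have hK := ((hc' x hxT u huX w hw huw).sdiff (Set.finite_lt_nat N)).image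
      (f := fun k => Nat.nth (fun j => ω j = u) k + 1) fun k _ k' _ hkk' =>
        Nat.nth_injective hinf (Nat.succ_injective hkk')
    refine hK.mono ?_
    rintro _ ⟨k, ⟨hk, hkN⟩, rfl⟩
    have hku : ω (Nat.nth (fun j => ω j = u) k) = u := Nat.nth_mem_of_infinite hinf k
    have hkN' : N ≤ Nat.nth (fun j => ω j = u) k :=
      (not_lt.1 hkN).trans ((Nat.nth_strictMono hinf).id_le k)
    have := hnext _ hkN' (hku.symm ▸ huX :) (hku.symm ▸ h1 :)
    simp only [hku, Nat.count_nth_of_infinite hinf] at this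
    exact this.trans hk

end RoundRobin

/-! ### The two inclusions -/

section AlmostSure

variable [Finite V] [MeasurableSpace V] [DiscreteMeasurableSpace V]

theorem almostSure_subset_almostSure_reach (P : MDP V) {ψ : Set (ℕ → V)} (hψ : ψ ⊆ P.plays)
    (hInf : P.DeterminedByInf ψ) :
    P.almostSure ψ ⊆ P.almostSure (P.reach (⋃₀ {X | P.IsGoodEndComponent ψ X})) := by
  rintro v ⟨σ, hσ⟩
  refine ⟨σ, le_antisymm prob_le_one ?_⟩
  rw [← hσ]
  -- `ψ` need not be measurable, so its measure is compared through an almost sure inclusion.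
  refine measure_mono_ae ?_
  filter_upwards [P.ae_mem_infOften_of_edge σ v] with ω hω hωψ
  have hplay := hψ hωψ
  obtain ⟨N, hN⟩ := eventually_mem_infOften ω
  exact ⟨hplay, N, infOften ω, ⟨P.isEndComponent_infOften hplay hω, fun ω' hω' he =>
    (hInf ω hplay ω' hω' he.symm).1 hωψ⟩, hN N le_rfl⟩

theorem almostSure_reach_subset_almostSure (P : MDP V) {ψ : Set (ℕ → V)} {𝒳 : Set (Set V)}
    (h𝒳 : ∀ X ∈ 𝒳, P.IsGoodEndComponent ψ X) :
    P.almostSure (P.reach (⋃₀ 𝒳)) ⊆ P.almostSure ψ := by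
  rintro v ⟨σ, hσ⟩
  -- The membership premise sits under the existential so that `choose` yields total functions, with
  -- irrelevant values off the target.
  have h1 : ∀ x, ∃ X : Set V, x ∈ ⋃₀ 𝒳 → X ∈ 𝒳 ∧ x ∈ X := fun x => by
    by_cases hx : x ∈ ⋃₀ 𝒳
    · obtain ⟨X, hX, hxX⟩ := hx
      exact ⟨X, fun _ => ⟨hX, hxX⟩⟩
    · exact ⟨∅, fun h => absurd h hx⟩
  choose comp hcomp using h1
  have h2 : ∀ x u, ∃ c : ℕ → V, x ∈ ⋃₀ 𝒳 → u ∈ comp x →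
      (∀ k, c k ∈ comp x ∧ P.Edge u (c k)) ∧
        ∀ w ∈ comp x, P.Edge u w → {k | c k = w}.Infinite := fun x u => by
    by_cases h : x ∈ ⋃₀ 𝒳 ∧ u ∈ comp x
    · obtain ⟨c, hc⟩ := (h𝒳 _ (hcomp x h.1).1).isEndComponent.exists_enumeration h.2
      exact ⟨c, fun _ _ => hc⟩
    · exact ⟨fun _ => u, fun hx hu => absurd ⟨hx, hu⟩ h⟩
  choose c hc using h2
  have key := P.ae_infOften_roundRobin σ (T := ⋃₀ 𝒳) (comp := comp) (c := c)
    (fun x hx => ⟨(hcomp x hx).2, (h𝒳 _ (hcomp x hx).1).isEndComponent⟩)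
    (fun x hx u hu => (hc x u hx hu).1) (fun x hx u hu => (hc x u hx hu).2) hσ
  refine ⟨P.roundRobin σ fun x hx u hu => (hc x u hx hu).1, le_antisymm prob_le_one ?_⟩
  rw [← measure_univ (μ := P.pr (P.roundRobin σ fun x hx u hu => (hc x u hx hu).1) v)]
  refine measure_mono_ae ?_
  filter_upwards [key] with ω ⟨hω, x, hx, he⟩ _
  exact (h𝒳 _ (hcomp x hx).1).good ω hω he

end AlmostSure

end MDP

theorem mainTheorem11 {V : Type*} [Finite V] [MeasurableSpace V] [DiscreteMeasurableSpace V]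
    (P : MDP V) (ψ : Set (ℕ → V)) (hψ : ψ ⊆ P.plays) (hInf : P.DeterminedByInf ψ) :
    P.almostSure ψ = P.almostSure (P.reach (⋃₀ {X | P.IsGoodEndComponent ψ X})) ∧
    ∀ 𝒳 : Set (Set V), (∀ X ∈ 𝒳, P.IsGoodEndComponent ψ X) →
      P.almostSure (P.reach (⋃₀ 𝒳)) ⊆ P.almostSure ψ :=
  ⟨(P.almostSure_subset_almostSure_reach hψ hInf).antisymm
    (P.almostSure_reach_subset_almostSure fun _ hX => hX),
    fun _ h𝒳 => P.almostSure_reach_subset_almostSure h𝒳⟩
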